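/- Let $\mathrm{H}(C; A_1, A_2; B_1, B_2)$, with positive integers $C, A_1, A_2, B_1, B_2$, denote the tree that consists of a path of length $C$ (that is, with $C$ edges) with endpoints $u \ne v$, two pendent paths of lengths $A_1, A_2$ attached at $u$, and two pendent paths of lengths $B_1, B_2$ attached at $v$. The transmission of a vertex of a finite connected graph is the sum of its distances to all the other vertices; a connected graph is transmission irregular if its vertices have mutually distinct transmissions, and a graph is chemical if its maximum degree is at most four. Then for every integer $t \ge 0$, each of the seven trees (i) $\mathrm{H}(1 + t;\ 6 + 2t,\ 5 + 2t;\ 2 + t,\ 1)$, (ii) $\mathrm{H}(2 + t;\ 7 + 2t,\ 6 + 2t;\ 5 + t,\ 1)$, (iii) $\mathrm{H}(1 + 2t;\ 6 + 4t,\ 5 + 4t;\ 1 + 2t,\ 2)$, (iv) $\mathrm{H}(2 + 2t;\ 8 + 4t,\ 7 + 4t;\ 3 + 2t,\ 1)$, (v) $\mathrm{H}(3 + 2t;\ 8 + 4t,\ 7 + 4t;\ 6 + 2t,\ 1)$, (vi) $\mathrm{H}(1 + t;\ 7 + 4t,\ 6 + 4t;\ 6 + 3t,\ 1)$, (vii)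 $\mathrm{H}(2;\ 7 + 4t,\ 6 + 4t;\ 5 + 4t,\ 1)$ is a transmission irregular chemical tree of even order (that is, with an even number of vertices). -/

import Mathlib

/-- The transmission of `u`: the sum of the distances from `u` to all the vertices. -/
noncomputable def SimpleGraph.transmission {V : Type*} [Fintype V] (G : SimpleGraph V) (u : V) : ℕ :=
  ∑ v, G.dist u v

/-- A connected graph is transmission irregular when its vertices have mutually distinct
transmissions. -/
def SimpleGraph.IsTransmissionIrregular {V : Type*} [Fintype V] (G : SimpleGraph V) : Prop :=
  G.Connected ∧ Function.Injective G.transmission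

open Classical in
/-- A graph is chemical if its maximum vertex degree is at most four. -/
def SimpleGraph.IsChemical {V : Type*} [Fintype V] (G : SimpleGraph V) : Prop :=
  G.maxDegree ≤ 4

/-- The vertices of the double starlike tree `DS(C; A₁, …, A_k; B₁, …, B_m)`:
the `C + 1` vertices of the path joining the two branching vertices,
then the `A i` vertices (other than the branching vertex) of each pendent path at its start,
then the `B j` vertices (other than the branching vertex) of each pendent path at its end. -/
abbrev DSVertex (C : ℕ) {k m : ℕ} (A : Fin k → ℕ) (B : Fin m → ℕ) : Type :=
  Fin (C + 1) ⊕ (Σ i : Fin k, Fin (A i)) ⊕ (Σ j : Fin m, Fin (B j))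

/-- `DSLink p q`: `q` is the vertex directly following `p` on the joining path or on a pendent path
(every path being directed away from the start of the joining path). -/
def DSLink (C : ℕ) {k m : ℕ} (A : Fin k → ℕ) (B : Fin m → ℕ) :
    DSVertex C A B → DSVertex C A B → Prop
  | .inl x, .inl y => y.val = x.val + 1
  | .inl x, .inr (.inl ⟨_, y⟩) => x.val = 0 ∧ y.val = 0
  | .inl x, .inr (.inr ⟨_, y⟩) => x.val = C ∧ y.val = 0
  | .inr (.inl ⟨i, x⟩), .inr (.inl ⟨i', y⟩) => i = i' ∧ y.val = x.val + 1
  | .inr (.inr ⟨j, x⟩), .inr (.inr ⟨j', y⟩) => j = j' ∧ y.val = x.val + 1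
  | _, _ => False

/-- The double starlike tree `DS(C; A₁, …, A_k; B₁, …, B_m)` (for `C ≥ 1`): a path of length `C`,
with pendent paths of lengths `A₁, …, A_k` attached at its start and pendent paths of lengths
`B₁, …, B_m` attached at its end. -/
def doubleStarlike (C : ℕ) {k m : ℕ} (A : Fin k → ℕ) (B : Fin m → ℕ) :
    SimpleGraph (DSVertex C A B) :=
  SimpleGraph.fromRel (DSLink C A B)

/-- The H-tree `H(C; A₁, A₂; B₁, B₂)`: the double starlike tree with two pendent paths at each of
its two branching vertices, which thus have degree three. -/
abbrev hTree (C A₁ A₂ B₁ B₂ : ℕ) : SimpleGraph (DSVertex C ![A₁, A₂] ![B₁, B₂]) :=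
  doubleStarlike C ![A₁, A₂] ![B₁, B₂]

/-- `G` is a transmission irregular chemical tree of even order. -/
structure SimpleGraph.IsEvenTIChemicalTree {V : Type*} [Fintype V] (G : SimpleGraph V) : Prop where
  isTree : G.IsTree
  isChemical : G.IsChemical
  even_order : Even (Fintype.card V)
  isTransmissionIrregular : G.IsTransmissionIrregular

/-!
The graph is a tree because every edge is the only one between the vertices beyond it and the
rest (`isEdgeCut_of_link`), hence a bridge. The same cuts give the transmissions: crossing an edge
away from the start of the joining path changes the transmission by `n - 2 s`, where `n` is the
number of vertices and `s` the number of those beyond the edge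
(`SimpleGraph.IsEdgeCut.transmission_right`). As `s` drops by one with each step along a path, the
transmission is a quadratic polynomial with leading coefficient one in the position on that path
(`transmission_inl`, `transmission_inr_inl`, `transmission_inr_inr`). For even `n` the halved
transmission is therefore a shifted triangular number `T x + c`, where `T x = x (x + 1) / 2` and
`x` runs through an interval of integers.

In each of the families the data `x` and `c` can be chosen linear in the parameter `t` and in the
position. An equality `T x + c = T y + d` with `x = y + k` reads `d - c = k x - k (k - 1) / 2`,
which is linear once `k` is fixed. Since `d - c` is small compared with `x`, only the first few
values of `k` can occur, and each of them is excluded by size or by parity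
(`triangularCases_of_eq`, `hTree_isEvenTIChemicalTree`).
-/

/-! ### Cutting a graph at an edge -/

namespace SimpleGraph

variable {V : Type*} {G : SimpleGraph V} {x y : V} {S : V → Prop}

/-- The edge `xy` is the only edge between the vertices outside `S`, among them `x`, and the
vertices in `S`, among them `y`. -/
structure IsEdgeCut (G : SimpleGraph V) (x y : V) (S : V → Prop) : Prop where
  adj : G.Adj x y
  left : ¬ S x
  right : S y
  unique : ∀ a b, ¬ S a → S b → G.Adj a b → a = x ∧ b = y

namespace IsEdgeCut

theorem symm (h : G.IsEdgeCut x y S) : G.IsEdgeCut y x (fun v => ¬ S v) where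
  adj := h.adj.symm
  left := not_not.2 h.right
  right := h.left
  unique a b ha hb hab := (h.unique b a hb (not_not.1 ha) hab.symm).symm

/-- A walk from the far side to `x` has to reach `y` before it can cross the edge. -/
theorem dist_lt_length (h : G.IsEdgeCut x y S) (hG : G.Connected) {w : V} (hw : S w)
    (p : G.Walk w x) : G.dist w y + 1 ≤ p.length := by
  suffices ∀ {w v : V} (p : G.Walk w v), v = x → S w → G.dist w y + 1 ≤ p.length from
    this p rfl hw
  intro w v p
  induction p with
  | nil => rintro rfl hw; exact absurd hw h.left
  | @cons w w' v hadj p ih =>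
    intro hv hw
    rw [Walk.length_cons]
    by_cases hw' : S w'
    · have h1 := ih hv hw'
      have h2 := hG.dist_triangle (u := w) (v := w') (w := y)
      rw [dist_eq_one_iff_adj.2 hadj] at h2
      omega
    · obtain ⟨-, rfl⟩ := h.unique w' w hw' hw hadj.symm
      simp

theorem dist_left (h : G.IsEdgeCut x y S) (hG : G.Connected) {w : V} (hw : S w) :
    G.dist x w = G.dist y w + 1 := by
  rw [dist_comm (u := x), dist_comm (u := y)]
  obtain ⟨p, hp⟩ := hG.exists_walk_length_eq_dist w x
  have h1 := h.dist_lt_length hG hw p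
  have h2 := hG.dist_triangle (u := w) (v := y) (w := x)
  rw [dist_eq_one_iff_adj.2 h.adj.symm] at h2
  omega

theorem dist_right (h : G.IsEdgeCut x y S) (hG : G.Connected) {w : V} (hw : ¬ S w) :
    G.dist y w = G.dist x w + 1 :=
  h.symm.dist_left hG hw

/-- Moving across the edge of a cut brings the vertices on the far side closer by one and takes
the others farther away by one. -/
theorem transmission_right [Fintype V] [DecidablePred S] (h : G.IsEdgeCut x y S)
    (hG : G.Connected) :
    (G.transmission y : ℤ) =
      G.transmission x + Fintype.card V - 2 * ∑ v, if S v then 1 else 0 := by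
  have key : ∀ v, (G.dist y v : ℤ) = G.dist x v + 1 - 2 * (if S v then 1 else 0) := by
    intro v
    by_cases hv : S v
    · have := h.dist_left hG hv
      simp only [hv, if_true]; omega
    · have := h.dist_right hG hv
      simp only [hv, if_false]; omega
  simp only [transmission, Nat.cast_sum, key, Finset.sum_sub_distrib, Finset.sum_add_distrib,
    Finset.mul_sum]
  simp

theorem isBridge (h : G.IsEdgeCut x y S) : G.IsBridge s(x, y) := by
  rw [isBridge_iff]
  rintro ⟨p⟩
  -- a walk avoiding the edge `xy` cannot leave the side of `x`
  suffices ∀ {a b : V} (p : (G.deleteEdges {s(x, y)}).Walk a b), ¬ S a → ¬ S b from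
    this p h.left h.right
  intro a b p
  induction p with
  | nil => exact id
  | @cons a c b hadj p ih =>
    intro ha
    refine ih fun hc => ?_
    rw [deleteEdges_adj] at hadj
    obtain ⟨rfl, rfl⟩ := h.unique a c ha hc hadj.1
    exact hadj.2 rfl

end IsEdgeCut

end SimpleGraph

/-! ### Double starlike trees -/

section DoubleStarlike

variable {C k m : ℕ} {A : Fin k → ℕ} {B : Fin m → ℕ}

/-- `DSBelow y v`: the path from the start of the joining path to `v` passes through `y`; for `y`
on the joining path other than its start (at the start itself, the pendent paths attached there
are left out). -/
def DSBelow : DSVertex C A B → DSVertex C A B → Prop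
  | .inl x, .inl y => x.val ≤ y.val
  | .inl _, .inr (.inr _) => True
  | .inr (.inl ⟨i, x⟩), .inr (.inl ⟨i', y⟩) => i = i' ∧ x.val ≤ y.val
  | .inr (.inr ⟨j, x⟩), .inr (.inr ⟨j', y⟩) => j = j' ∧ x.val ≤ y.val
  | _, _ => False

theorem dsBelow_inl_inl {x y : Fin (C + 1)} :
    DSBelow (.inl x : DSVertex C A B) (.inl y) ↔ x.val ≤ y.val := by
  simp [DSBelow]

theorem doubleStarlike_adj_of_link {x y : DSVertex C A B} (h : DSLink C A B x y) :
    (doubleStarlike C A B).Adj x y := by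
  refine (SimpleGraph.fromRel_adj _ _ _).2 ⟨?_, Or.inl h⟩
  rintro rfl
  rcases x with x | ⟨i, x⟩ | ⟨i, x⟩ <;> simp [DSLink] at h

theorem link_inl_succ (i : ℕ) (hi : i + 1 < C + 1) :
    DSLink C A B (.inl ⟨i, by omega⟩) (.inl ⟨i + 1, hi⟩) :=
  rfl

theorem link_inr_inl_zero (i : Fin k) (h : 0 < A i) :
    DSLink C A B (.inl 0) (.inr (.inl ⟨i, 0, h⟩)) :=
  ⟨rfl, rfl⟩

theorem link_inr_inl_succ (i : Fin k) (j : ℕ) (hj : j + 1 < A i) :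
    DSLink C A B (.inr (.inl ⟨i, j, by omega⟩)) (.inr (.inl ⟨i, j + 1, hj⟩)) :=
  ⟨rfl, rfl⟩

theorem link_inr_inr_zero (i : Fin m) (h : 0 < B i) :
    DSLink C A B (.inl ⟨C, by omega⟩) (.inr (.inr ⟨i, 0, h⟩)) :=
  ⟨rfl, rfl⟩

theorem link_inr_inr_succ (i : Fin m) (j : ℕ) (hj : j + 1 < B i) :
    DSLink C A B (.inr (.inr ⟨i, j, by omega⟩)) (.inr (.inr ⟨i, j + 1, hj⟩)) :=
  ⟨rfl, rfl⟩

theorem sigma_fin_mk_eq_iff {ι : Type*} {n : ι → ℕ} {i j : ι} {a : Fin (n i)} {b : Fin (n j)} :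
    (⟨i, a⟩ : Σ i, Fin (n i)) = ⟨j, b⟩ ↔ i = j ∧ a.val = b.val := by
  constructor
  · rintro ⟨rfl, rfl⟩
    exact ⟨rfl, rfl⟩
  · rintro ⟨rfl, h⟩
    rw [Fin.ext h]

/-- Every edge of a double starlike tree cuts off the vertices beyond it. -/
theorem isEdgeCut_of_link {x y : DSVertex C A B} (h : DSLink C A B x y) :
    (doubleStarlike C A B).IsEdgeCut x y (DSBelow y) where
  adj := doubleStarlike_adj_of_link h
  left := by
    rcases x with x | ⟨i, x⟩ | ⟨i, x⟩ <;> rcases y with y | ⟨i', y⟩ | ⟨i', y⟩ <;>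
      simp [DSLink, DSBelow] at h ⊢
    · omega
    all_goals intro; omega
  right := by
    rcases y with y | ⟨i, y⟩ | ⟨i, y⟩ <;> simp [DSBelow]
  unique a b ha hb hab := by
    replace hab := ((SimpleGraph.fromRel_adj _ _ _).1 hab).2
    rcases x with x | ⟨i, x⟩ | ⟨i, x⟩ <;> rcases y with y | ⟨i', y⟩ | ⟨i', y⟩ <;>
      simp only [DSLink] at h <;>
      rcases a with a | ⟨j, a⟩ | ⟨j, a⟩ <;> rcases b with b | ⟨j', b⟩ | ⟨j', b⟩ <;>
      simp only [DSLink, DSBelow, not_true_eq_false, or_false, false_or] at ha hb hab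
    all_goals
      simp only [Sum.inl.injEq, Sum.inr.injEq, sigma_fin_mk_eq_iff, Fin.ext_iff, reduceCtorEq] at *
      omega

theorem doubleStarlike_connected : (doubleStarlike C A B).Connected := by
  have main : ∀ i (hi : i < C + 1), (doubleStarlike C A B).Reachable (.inl 0) (.inl ⟨i, hi⟩) := by
    intro i
    induction i with
    | zero => exact fun _ => .rfl
    | succ i ih =>
      exact fun hi =>
        (ih (by omega)).trans (doubleStarlike_adj_of_link (link_inl_succ i hi)).reachable
  refine SimpleGraph.connected_iff_exists_forall_reachable _ |>.2 ⟨.inl 0, ?_⟩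
  rintro (⟨i, hi⟩ | ⟨i, ⟨j, hj⟩⟩ | ⟨i, ⟨j, hj⟩⟩)
  · exact main i hi
  · induction j with
    | zero => exact (doubleStarlike_adj_of_link (link_inr_inl_zero i hj)).reachable
    | succ j ih =>
      exact (ih (by omega)).trans (doubleStarlike_adj_of_link (link_inr_inl_succ i j hj)).reachable
  · induction j with
    | zero =>
      exact (main C (by omega)).trans
        (doubleStarlike_adj_of_link (link_inr_inr_zero i hj)).reachable
    | succ j ih =>
      exact (ih (by omega)).trans (doubleStarlike_adj_of_link (link_inr_inr_succ i j hj)).reachable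

theorem doubleStarlike_isTree : (doubleStarlike C A B).IsTree := by
  refine ⟨doubleStarlike_connected, SimpleGraph.isAcyclic_iff_forall_adj_isBridge.2 ?_⟩
  intro a b hab
  rcases ((SimpleGraph.fromRel_adj _ _ _).1 hab).2 with h | h
  · exact (isEdgeCut_of_link h).isBridge
  · rw [Sym2.eq_swap]
    exact (isEdgeCut_of_link h).isBridge

open Classical in
theorem transmission_of_link {x y : DSVertex C A B} (h : DSLink C A B x y) :
    ((doubleStarlike C A B).transmission y : ℤ) =
      (doubleStarlike C A B).transmission x + (C + 1 + ∑ i, A i + ∑ j, B j) -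
        2 * ∑ v, if DSBelow y v then 1 else 0 := by
  rw [(isEdgeCut_of_link h).transmission_right doubleStarlike_connected]
  simp [add_assoc]

theorem sum_ite_le_fin {n i : ℕ} (hi : i ≤ n) :
    (∑ j : Fin n, if i ≤ j.val then (1 : ℤ) else 0) = n - i := by
  rw [Fin.sum_univ_eq_sum_range (fun j => if i ≤ j then (1 : ℤ) else 0), ← Finset.sum_filter,
    show (Finset.range n).filter (i ≤ ·) = Finset.Ico i n by ext; simp; omega]
  simp [Nat.cast_sub hi]

theorem transmission_inl (i : ℕ) (hi : i < C + 1) :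
    ((doubleStarlike C A B).transmission (.inl ⟨i, hi⟩) : ℤ) =
      (doubleStarlike C A B).transmission (.inl 0) +
        i * (∑ i, A i - ∑ j, B j - C + i) := by
  classical
  have below : ∀ i (hi : i < C + 1), (∑ v : DSVertex C A B,
      if DSBelow (.inl ⟨i, hi⟩) v then (1 : ℤ) else 0) = C + 1 - i + ∑ j, B j := by
    intro i hi
    simp only [Fintype.sum_sum_type, Fintype.sum_sigma]
    have h := sum_ite_le_fin hi.le
    push_cast at h
    simp only [dsBelow_inl_inl, h]
    simp [DSBelow]
  induction i with
  | zero => simp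
  | succ i ih =>
    rw [transmission_of_link (link_inl_succ i hi), ih, below]
    push_cast; ring

theorem transmission_inr_inl (i : Fin k) (j : ℕ) (hj : j < A i) :
    ((doubleStarlike C A B).transmission (.inr (.inl ⟨i, j, hj⟩)) : ℤ) =
      (doubleStarlike C A B).transmission (.inl 0) +
        (j + 1) * (C + 1 + ∑ i, A i + ∑ j, B j - 2 * A i + j) := by
  classical
  have below : ∀ j (hj : j < A i), (∑ v : DSVertex C A B,
      if DSBelow (.inr (.inl ⟨i, j, hj⟩)) v then (1 : ℤ) else 0) = A i - j := by
    intro j hj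
    simp only [Fintype.sum_sum_type, Fintype.sum_sigma]
    simp only [DSBelow]
    rw [Finset.sum_eq_single i (by intro b _ hb; simp [hb.symm]) (by simp)]
    simp [sum_ite_le_fin hj.le]
  induction j with
  | zero =>
    rw [transmission_of_link (link_inr_inl_zero i hj), below]
    push_cast; ring
  | succ j ih =>
    rw [transmission_of_link (link_inr_inl_succ i j hj), ih, below]
    push_cast; ring

theorem transmission_inr_inr (i : Fin m) (j : ℕ) (hj : j < B i) :
    ((doubleStarlike C A B).transmission (.inr (.inr ⟨i, j, hj⟩)) : ℤ) =
      (doubleStarlike C A B).transmission (.inl 0) + C * (∑ i, A i - ∑ j, B j) +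
        (j + 1) * (C + 1 + ∑ i, A i + ∑ j, B j - 2 * B i + j) := by
  classical
  have below : ∀ j (hj : j < B i), (∑ v : DSVertex C A B,
      if DSBelow (.inr (.inr ⟨i, j, hj⟩)) v then (1 : ℤ) else 0) = B i - j := by
    intro j hj
    simp only [Fintype.sum_sum_type, Fintype.sum_sigma]
    simp only [DSBelow]
    rw [Finset.sum_eq_single (f := fun b => ∑ x : Fin (B b), _) i
      (by intro b _ hb; simp [hb.symm]) (by simp)]
    simp [sum_ite_le_fin hj.le]
  induction j with
  | zero =>
    rw [transmission_of_link (link_inr_inr_zero i hj), below, transmission_inl]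
    push_cast; ring
  | succ j ih =>
    rw [transmission_of_link (link_inr_inr_succ i j hj), ih, below]
    push_cast; ring

end DoubleStarlike

/-! ### Degrees in an H-tree -/

theorem hTree_isChemical {C A₁ A₂ B₁ B₂ : ℕ} (hC : 1 ≤ C) : (hTree C A₁ A₂ B₁ B₂).IsChemical := by
  classical
  refine SimpleGraph.maxDegree_le_of_forall_degree_le _ _ fun v => ?_
  -- the neighbours of `v` are told apart by a label: `3` for the preceding vertex, and for a
  -- following vertex the path on which it lies; the pendent paths at the two ends may share labels
  -- because the two branching vertices differ
  let label : DSVertex C ![A₁, A₂] ![B₁, B₂] → ℕ := fun w =>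
    if DSLink _ _ _ w v then 3 else
      match w with
      | .inl _ => 0
      | .inr (.inl ⟨i, _⟩) => 1 + i.val
      | .inr (.inr ⟨j, _⟩) => 1 + j.val
  rw [← SimpleGraph.card_neighborFinset_eq_degree, ← Finset.card_range 4]
  refine Finset.card_le_card_of_injOn label ?_ ?_
  · intro w _
    simp only [label, Finset.coe_range, Set.mem_Iio]
    split_ifs
    · omega
    · rcases w with w | ⟨i, w⟩ | ⟨i, w⟩ <;> simp <;> omega
  · intro w hw w' hw' h
    have hw := ((SimpleGraph.fromRel_adj _ _ _).1 ((SimpleGraph.mem_neighborFinset _ _ _).1 hw)).2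
    have hw' := ((SimpleGraph.fromRel_adj _ _ _).1 ((SimpleGraph.mem_neighborFinset _ _ _).1 hw')).2
    simp only [label] at h
    rcases v with v | ⟨i, v⟩ | ⟨i, v⟩ <;> rcases w with w | ⟨j, w⟩ | ⟨j, w⟩ <;>
      rcases w' with w' | ⟨j', w'⟩ | ⟨j', w'⟩ <;> simp only [DSLink] at h hw hw'
    all_goals
      simp only [Sum.inl.injEq, Sum.inr.injEq, sigma_fin_mk_eq_iff, Fin.ext_iff, reduceCtorEq]
        at h hw hw' ⊢
      grind

/-! ### Transmissions in an H-tree -/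

/-- The five paths of which an H-tree consists: the joining path, the two pendent paths at its
start and the two at its end. -/
inductive HTreeArm
  | mid | a₁ | a₂ | b₁ | b₂

/-- The number of vertices on an arm of an H-tree; the branching vertices belong to the joining
path. -/
def hTreeArmCard (C A₁ A₂ B₁ B₂ : ℕ) : HTreeArm → ℕ
  | .mid => C + 1
  | .a₁ => A₁
  | .a₂ => A₂
  | .b₁ => B₁
  | .b₂ => B₂

/-- The transmission of the `i`-th vertex of an arm of an H-tree, less that of the start of the
joining path. -/
def hTreeExcess (C A₁ A₂ B₁ B₂ : ℤ) : HTreeArm → ℤ → ℤ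
  | .mid, i => i * (A₁ + A₂ - B₁ - B₂ - C + i)
  | .a₁, i => (i + 1) * (C + 1 - A₁ + A₂ + B₁ + B₂ + i)
  | .a₂, i => (i + 1) * (C + 1 + A₁ - A₂ + B₁ + B₂ + i)
  | .b₁, i => C * (A₁ + A₂ - B₁ - B₂) + (i + 1) * (C + 1 + A₁ + A₂ - B₁ + B₂ + i)
  | .b₂, i => C * (A₁ + A₂ - B₁ - B₂) + (i + 1) * (C + 1 + A₁ + A₂ + B₁ - B₂ + i)

/-- The arm on which a vertex lies. -/
def armOf {C A₁ A₂ B₁ B₂ : ℕ} : DSVertex C ![A₁, A₂] ![B₁, B₂] → HTreeArm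
  | .inl _ => .mid
  | .inr (.inl ⟨i, _⟩) => if i = 0 then .a₁ else .a₂
  | .inr (.inr ⟨j, _⟩) => if j = 0 then .b₁ else .b₂

/-- The position of a vertex on its arm. -/
def posOf {C A₁ A₂ B₁ B₂ : ℕ} : DSVertex C ![A₁, A₂] ![B₁, B₂] → ℕ
  | .inl x => x
  | .inr (.inl ⟨_, x⟩) => x
  | .inr (.inr ⟨_, x⟩) => x

section HTree

variable {C A₁ A₂ B₁ B₂ : ℕ}

theorem eq_of_armOf_eq_of_posOf_eq {v w : DSVertex C ![A₁, A₂] ![B₁, B₂]}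
    (h : armOf v = armOf w) (h' : posOf v = posOf w) : v = w := by
  rcases v with v | ⟨i, v⟩ | ⟨i, v⟩ <;> rcases w with w | ⟨j, w⟩ | ⟨j, w⟩ <;>
    simp only [armOf, posOf] at h h' <;>
    simp only [Sum.inl.injEq, Sum.inr.injEq, sigma_fin_mk_eq_iff, Fin.ext_iff, reduceCtorEq] <;>
    (try split_ifs at h) <;> omega

theorem posOf_lt (v : DSVertex C ![A₁, A₂] ![B₁, B₂]) :
    posOf v < hTreeArmCard C A₁ A₂ B₁ B₂ (armOf v) := by
  rcases v with ⟨x, hx⟩ | ⟨i, ⟨x, hx⟩⟩ | ⟨i, ⟨x, hx⟩⟩ <;> (try fin_cases i) <;> exact hx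

theorem hTree_transmission (v : DSVertex C ![A₁, A₂] ![B₁, B₂]) :
    ((hTree C A₁ A₂ B₁ B₂).transmission v : ℤ) =
      (hTree C A₁ A₂ B₁ B₂).transmission (.inl 0) +
        hTreeExcess C A₁ A₂ B₁ B₂ (armOf v) (posOf v) := by
  rcases v with ⟨x, hx⟩ | ⟨i, ⟨x, hx⟩⟩ | ⟨i, ⟨x, hx⟩⟩
  · rw [transmission_inl]
    simp only [Fin.sum_univ_two, armOf, posOf, hTreeExcess, Matrix.cons_val_zero,
      Matrix.cons_val_one]
    push_cast; ring
  · rw [transmission_inr_inl]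
    fin_cases i <;>
      simp [hTree, Fin.sum_univ_two, armOf, posOf, hTreeExcess, -mul_eq_mul_left_iff] <;> ring
  · rw [transmission_inr_inr]
    fin_cases i <;>
      simp [hTree, Fin.sum_univ_two, armOf, posOf, hTreeExcess, -mul_eq_mul_left_iff] <;> ring

end HTree

/-! ### Shifted triangular numbers -/

/-- The equation `x (x + 1) / 2 + c = y (y + 1) / 2 + d` between two shifted triangular numbers
with `y ≤ x`, spelled out according to `x - y`: a disjunction of linear conditions, which is
exact as long as `x - y ≤ 4`. -/
def TriangularCases (x c y d : ℤ) : Prop :=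
  (x = y ∧ d - c = 0) ∨ (x = y + 1 ∧ d - c = x) ∨ (x = y + 2 ∧ d - c = 2 * x - 1) ∨
    (x = y + 3 ∧ d - c = 3 * x - 3) ∨ (x = y + 4 ∧ d - c = 4 * x - 6) ∨
    (y + 5 ≤ x ∧ 5 * x - 10 ≤ d - c)

theorem triangularCases_of_eq {x c y d : ℤ} (hy : 0 ≤ y) (hyx : y ≤ x)
    (h : x * (x + 1) + 2 * c = y * (y + 1) + 2 * d) : TriangularCases x c y d := by
  obtain ⟨k, rfl⟩ : ∃ k, x = y + k := ⟨x - y, by ring⟩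
  have key : 2 * (d - c) = k * (2 * y + 1 + k) := by linear_combination -h
  unfold TriangularCases
  by_cases hk : 5 ≤ k
  · have : 5 * (y + k) - 10 ≤ d - c := by
      nlinarith [mul_nonneg (sub_nonneg.2 hk) (show (0 : ℤ) ≤ 2 * y + k - 4 by omega)]
    omega
  · have hk0 : 0 ≤ k := by omega
    interval_cases k <;> omega

section HTree

variable {C A₁ A₂ B₁ B₂ : ℕ}

/-- If the halved transmissions are, up to a common constant, triangular numbers `x (x + 1) / 2`
shifted by `c`, then it suffices for irregularity to check the linear conditions of
`TriangularCases` on `x` and `c`. -/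
theorem hTree_isEvenTIChemicalTree (hC : 1 ≤ C)
    (hn : Even (C + 1 + A₁ + A₂ + B₁ + B₂)) (K : ℤ) (x c : HTreeArm → ℕ → ℤ)
    (hx : ∀ k i, 0 ≤ x k i)
    (h : ∀ k i, i < hTreeArmCard C A₁ A₂ B₁ B₂ k →
      hTreeExcess C A₁ A₂ B₁ B₂ k i = K + x k i * (x k i + 1) + 2 * c k i)
    (hsep : ∀ k l i j, i < hTreeArmCard C A₁ A₂ B₁ B₂ k → j < hTreeArmCard C A₁ A₂ B₁ B₂ l →
      TriangularCases (x k i) (c k i) (x l j) (c l j) → k = l ∧ i = j) :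
    (hTree C A₁ A₂ B₁ B₂).IsEvenTIChemicalTree where
  isTree := doubleStarlike_isTree
  isChemical := hTree_isChemical hC
  even_order := by
    simpa [Fin.sum_univ_two, add_assoc] using hn
  isTransmissionIrregular := by
    refine ⟨doubleStarlike_connected, fun v w hvw => ?_⟩
    have hv := hTree_transmission v
    have hw := hTree_transmission w
    rw [h _ _ (posOf_lt v)] at hv
    rw [h _ _ (posOf_lt w)] at hw
    rw [hvw] at hv
    rcases le_total (x (armOf w) (posOf w)) (x (armOf v) (posOf v)) with hle | hle
    · obtain ⟨h1, h2⟩ := hsep _ _ _ _ (posOf_lt v) (posOf_lt w)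
        (triangularCases_of_eq (hx _ _) hle (by linarith))
      exact eq_of_armOf_eq_of_posOf_eq h1 h2
    · obtain ⟨h1, h2⟩ := hsep _ _ _ _ (posOf_lt w) (posOf_lt v)
        (triangularCases_of_eq (hx _ _) hle (by linarith))
      exact (eq_of_armOf_eq_of_posOf_eq h1 h2).symm

end HTree

/-! ### The families -/

/- In each family, `x` and `c` are as in `hTree_isEvenTIChemicalTree`, normalized by `c = 0` on the
first pendent path. The one or two vertices on the last pendent path get the `x` of the end of the
joining path, and their excess over that vertex is put into `c`. -/

theorem hTree_one_add_pendent_two_add (t : ℕ) :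
    (hTree (1 + t) (6 + 2 * t) (5 + 2 * t) (2 + t) 1).IsEvenTIChemicalTree := by
  refine hTree_isEvenTIChemicalTree (by omega) ⟨8 + 3 * t, by ring⟩ (-((2 + t) * (1 + t)))
    (fun k i => match k with
      | .mid => 3 + t + i
      | .a₁ => 2 + t + i
      | .a₂ => 3 + t + i
      | .b₁ => 6 + 2 * t + i
      | .b₂ => 4 + 2 * t)
    (fun k _ => match k with
      | .mid => -(5 + 2 * t)
      | .a₁ => 0
      | .a₂ => -(2 + t)
      | .b₁ => -(10 + 4 * t)
      | .b₂ => 2 + t) ?_ ?_ ?_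
  · intro k i
    cases k <;> positivity
  · intro k i hi
    cases k <;> simp only [hTreeExcess, hTreeArmCard] at hi ⊢ <;> push_cast
    case b₂ => simp [show i = 0 by omega]; ring
    all_goals ring
  · intro k l i j hi hj h
    cases k <;> cases l <;> dsimp only [hTreeArmCard, TriangularCases] at h hi hj <;>
      
      first | exact ⟨rfl, by omega⟩ | (exfalso; omega)

theorem hTree_two_add_pendent_five_add (t : ℕ) :
    (hTree (2 + t) (7 + 2 * t) (6 + 2 * t) (5 + t) 1).IsEvenTIChemicalTree := by
  refine hTree_isEvenTIChemicalTree (by omega) ⟨11 + 3 * t, by ring⟩ (-((4 + t) * (3 + t)))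
    (fun k i => match k with
      | .mid => 2 + t + i
      | .a₁ => 4 + t + i
      | .a₂ => 5 + t + i
      | .b₁ => 6 + 2 * t + i
      | .b₂ => 4 + 2 * t)
    (fun k _ => match k with
      | .mid => 3 + t
      | .a₁ => 0
      | .a₂ => -(4 + t)
      | .b₁ => -(2 + t)
      | .b₂ => 13 + 4 * t) ?_ ?_ ?_
  · intro k i
    cases k <;> positivity
  · intro k i hi
    cases k <;> simp only [hTreeExcess, hTreeArmCard] at hi ⊢ <;> push_cast
    case b₂ => simp [show i = 0 by omega]; ring
    all_goals ring
  · intro k l i j hi hj h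
    cases k <;> cases l <;> dsimp only [hTreeArmCard, TriangularCases] at h hi hj <;>
      
      first | exact ⟨rfl, by omega⟩ | (exfalso; omega)

theorem hTree_one_add_two_mul_pendent_one_add_two_mul (t : ℕ) :
    (hTree (1 + 2 * t) (6 + 4 * t) (5 + 4 * t) (1 + 2 * t) 2).IsEvenTIChemicalTree := by
  refine hTree_isEvenTIChemicalTree (by omega) ⟨8 + 6 * t, by ring⟩ (-((2 + 2 * t) * (1 + 2 * t)))
    (fun k i => match k with
      | .mid => 3 + 2 * t + i
      | .a₁ => 2 + 2 * t + i
      | .a₂ => 3 + 2 * t + i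
      | .b₁ => 7 + 4 * t + i
      | .b₂ => 4 + 4 * t)
    (fun k i => match k with
      | .mid => -(5 + 4 * t)
      | .a₁ => 0
      | .a₂ => -(2 + 2 * t)
      | .b₁ => -(16 + 12 * t)
      | .b₂ => if i = 0 then 1 + 2 * t else 8 + 8 * t) ?_ ?_ ?_
  · intro k i
    cases k <;> positivity
  · intro k i hi
    cases k <;> simp only [hTreeExcess, hTreeArmCard] at hi ⊢ <;> push_cast
    case b₂ => interval_cases i <;> simp <;> ring
    all_goals ring
  · intro k l i j hi hj h
    cases k <;> cases l <;> dsimp only [hTreeArmCard, TriangularCases] at h hi hj <;>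
      (try split_ifs at h) <;>
      first | exact ⟨rfl, by omega⟩ | (exfalso; omega)

theorem hTree_three_add_two_mul_pendent_six_add_two_mul (t : ℕ) :
    (hTree (3 + 2 * t) (8 + 4 * t) (7 + 4 * t) (6 + 2 * t) 1).IsEvenTIChemicalTree := by
  refine hTree_isEvenTIChemicalTree (by omega) ⟨13 + 6 * t, by ring⟩ (-((5 + 2 * t) * (4 + 2 * t)))
    (fun k i => match k with
      | .mid => 2 + 2 * t + i
      | .a₁ => 5 + 2 * t + i
      | .a₂ => 6 + 2 * t + i
      | .b₁ => 7 + 4 * t + i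
      | .b₂ => 5 + 4 * t)
    (fun k _ => match k with
      | .mid => 7 + 4 * t
      | .a₁ => 0
      | .a₂ => -(5 + 2 * t)
      | .b₁ => 1
      | .b₂ => 19 + 10 * t) ?_ ?_ ?_
  · intro k i
    cases k <;> positivity
  · intro k i hi
    cases k <;> simp only [hTreeExcess, hTreeArmCard] at hi ⊢ <;> push_cast
    case b₂ => simp [show i = 0 by omega]; ring
    all_goals ring
  · intro k l i j hi hj h
    cases k <;> cases l <;> dsimp only [hTreeArmCard, TriangularCases] at h hi hj <;>
      
      first | exact ⟨rfl, by omega⟩ | (exfalso; omega)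

theorem hTree_one_add_pendent_six_add_three_mul (t : ℕ) :
    (hTree (1 + t) (7 + 4 * t) (6 + 4 * t) (6 + 3 * t) 1).IsEvenTIChemicalTree := by
  refine hTree_isEvenTIChemicalTree (by omega) ⟨11 + 6 * t, by ring⟩ (-((4 + 2 * t) * (3 + 2 * t)))
    (fun k i => match k with
      | .mid => 2 + 2 * t + i
      | .a₁ => 4 + 2 * t + i
      | .a₂ => 5 + 2 * t + i
      | .b₁ => 5 + 3 * t + i
      | .b₂ => 3 + 3 * t)
    (fun k _ => match k with
      | .mid => 3 + 2 * t
      | .a₁ => 0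
      | .a₂ => -(4 + 2 * t)
      | .b₁ => -(1 + t)
      | .b₂ => 13 + 8 * t) ?_ ?_ ?_
  · intro k i
    cases k <;> positivity
  · intro k i hi
    cases k <;> simp only [hTreeExcess, hTreeArmCard] at hi ⊢ <;> push_cast
    case b₂ => simp [show i = 0 by omega]; ring
    all_goals ring
  · intro k l i j hi hj h
    cases k <;> cases l <;> dsimp only [hTreeArmCard, TriangularCases] at h hi hj <;>
      
      first | exact ⟨rfl, by omega⟩ | (exfalso; omega)

theorem hTree_two_pendent_five_add_four_mul (t : ℕ) :
    (hTree 2 (7 + 4 * t) (6 + 4 * t) (5 + 4 * t) 1).IsEvenTIChemicalTree := by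
  refine hTree_isEvenTIChemicalTree (by omega) ⟨11 + 6 * t, by ring⟩ (-((4 + 2 * t) * (3 + 2 * t)))
    (fun k i => match k with
      | .mid => 2 + 2 * t + i
      | .a₁ => 4 + 2 * t + i
      | .a₂ => 5 + 2 * t + i
      | .b₁ => 6 + 2 * t + i
      | .b₂ => 4 + 2 * t)
    (fun k _ => match k with
      | .mid => 3 + 2 * t
      | .a₁ => 0
      | .a₂ => -(4 + 2 * t)
      | .b₁ => -2
      | .b₂ => 13 + 8 * t) ?_ ?_ ?_
  · intro k i
    cases k <;> positivity
  · intro k i hi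
    cases k <;> simp only [hTreeExcess, hTreeArmCard] at hi ⊢ <;> push_cast
    case b₂ => simp [show i = 0 by omega]; ring
    all_goals ring
  · intro k l i j hi hj h
    cases k <;> cases l <;> dsimp only [hTreeArmCard, TriangularCases] at h hi hj <;>
      
      first | exact ⟨rfl, by omega⟩ | (exfalso; omega)

theorem theorem9 (t : ℕ) :
    (hTree (1 + t) (6 + 2 * t) (5 + 2 * t) (2 + t) 1).IsEvenTIChemicalTree ∧
    (hTree (2 + t) (7 + 2 * t) (6 + 2 * t) (5 + t) 1).IsEvenTIChemicalTree ∧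
    (hTree (1 + 2 * t) (6 + 4 * t) (5 + 4 * t) (1 + 2 * t) 2).IsEvenTIChemicalTree ∧
    (hTree (2 + 2 * t) (8 + 4 * t) (7 + 4 * t) (3 + 2 * t) 1).IsEvenTIChemicalTree ∧
    (hTree (3 + 2 * t) (8 + 4 * t) (7 + 4 * t) (6 + 2 * t) 1).IsEvenTIChemicalTree ∧
    (hTree (1 + t) (7 + 4 * t) (6 + 4 * t) (6 + 3 * t) 1).IsEvenTIChemicalTree ∧
    (hTree 2 (7 + 4 * t) (6 + 4 * t) (5 + 4 * t) 1).IsEvenTIChemicalTree := by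
  refine ⟨hTree_one_add_pendent_two_add t, hTree_two_add_pendent_five_add t,
    hTree_one_add_two_mul_pendent_one_add_two_mul t, ?_,
    hTree_three_add_two_mul_pendent_six_add_two_mul t,
    hTree_one_add_pendent_six_add_three_mul t, hTree_two_pendent_five_add_four_mul t⟩
  -- the trees of the fourth family are those of the first with odd parameter
  have h := hTree_one_add_pendent_two_add (2 * t + 1)
  rwa [show 1 + (2 * t + 1) = 2 + 2 * t by ring, show 6 + 2 * (2 * t + 1) = 8 + 4 * t by ring,
    show 5 + 2 * (2 * t + 1) = 7 + 4 * t by ring, show 2 + (2 * t + 1) = 3 + 2 * t by ring] at h
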